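/- A Hausdorff topological group $G$ is called totally torsion free if for every closed subgroup $K$ of $G$ the abelianization of $K$, that is, the quotient $K/\overline{[K,K]}$ of $K$ by the closure of its commutator subgroup, is torsion free. Let $F$ be a field of arbitrary characteristic that contains all roots of unity, i.e. every element $\zeta$ of an algebraic closure of $F$ with $\zeta^n=1$ for some integer $n\geq 1$ lies in $F$. Then the absolute Galois group $G_F$ of $F$, with its Krull topology, is totally torsion free. -/

import Mathlib

/-- A topological group `G` is totally torsion free if it is Hausdorff and every closed subgroup `K`
of `G` has torsion-free (topological) abelianization, the latter being the quotient of `K` by the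
closure of its commutator subgroup. The abelianization is a commutative group, so that
`IsMulTorsionFree` says exactly that it has no nontrivial element of finite order. -/
def TotallyTorsionFree (G : Type*) [Group G] [TopologicalSpace G] [IsTopologicalGroup G] : Prop :=
  T2Space G ∧
    ∀ K : Subgroup G, IsClosed (K : Set G) → IsMulTorsionFree (TopologicalAbelianization K)

/-- The field `F` contains all roots of unity: every root of unity, of any order, of an algebraic
closure of `F` lies in `F`. -/
def ContainsAllRootsOfUnity (F : Type*) [Field F] : Prop :=
  ∀ (n : ℕ), 0 < n → ∀ ζ : AlgebraicClosure F, ζ ^ n = 1 →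
    ζ ∈ Set.range (algebraMap F (AlgebraicClosure F))

/-!
The topological abelianization of a closed subgroup `K` of the Galois group is torsion free because
its group of continuous characters is divisible. Concretely, suppose that `p` is prime and that
`σ ^ p`, but not `σ`, lies in the closure of the commutator subgroup of `K`. Some finite quotient of
`K`, its image `H` in the automorphism group of a finite normal extension `M` of `F`, has a
character `χ` with values in `ZMod (p ^ e)` and `χ σ ≠ 0`
(`exists_character_ne_one_of_notMem_commutator`). If `χ` is `p` times a continuous character `ψ` of
`K` into a larger cyclic `p`-group, then `χ σ` is the value of `ψ` at `σ ^ p`, which vanishes: a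
contradiction.

The character `ψ` comes from one of two sources.

* If `p` is invertible in `F`, replace `χ` by its composite with a homomorphism of `ZMod (p ^ e)`
  into the roots of unity of `F` that does not kill `χ σ`. By Hilbert 90 this composite is
  `τ ↦ τ α / α` for some `α` in `M`, and `ψ` is `τ ↦ τ β / β` with `β ^ p = α`. It is a homomorphism
  because its values are roots of unity, hence lie in `F` (`kummer_character_eq_one`).
* If `F` has characteristic `p`, it suffices to lift `χ` to `ZMod (p ^ (e + 1))`, as `ZMod (p ^ e)`
  is identified with the multiples of `p` there and `χ` with `p` times its lift. The obstruction is
  the cocycle of carries, with values in `ZMod p`. It becomes a coboundary in `M`, whose first and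
  second cohomology vanish, and an Artin–Schreier equation makes the cochain take values in `ZMod p`
  (`artinSchreier_character_eq_one`).

The argument works with the finite quotients `H` directly, for arbitrary subgroups `K`, so it needs
neither the infinite Galois correspondence nor the separability of the algebraic closure.
-/

open scoped Topology

/-! ### Cohomology of a finite group acting faithfully on a field -/

section FiniteGroup

variable {H M : Type*} [Group H] [Fintype H] [Field M] [MulSemiringAction H M] [FaithfulSMul H M]

/-- Dedekind independence of the automorphisms of `M` induced by `H`. -/
theorem exists_sum_mul_smul_ne_zero (w : H → M) (h : H) (hw : w h ≠ 0) :
    ∃ x : M, ∑ g, w g * g • x ≠ 0 := by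
  by_contra! hx
  have hinj : Function.Injective fun g : H => (MulSemiringAction.toRingHom H M g : M →* M) :=
    fun a b hab => FaithfulSMul.eq_of_smul_eq_smul fun x : M => DFunLike.congr_fun hab x
  have hli := (linearIndependent_monoidHom M M).comp _ hinj
  exact hw (Fintype.linearIndependent_iff.1 hli w
    (by ext x; simpa [Finset.sum_apply] using hx x) h)

/-- A form of Hilbert 90: a character of `H` with values fixed by `H` is `g ↦ g • α / α`. -/
theorem exists_smul_eq_character_mul (θ : H →* Mˣ) (hθ : ∀ g h : H, g • (θ h : M) = θ h) :
    ∃ α : M, α ≠ 0 ∧ ∀ g : H, g • α = θ g * α := by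
  obtain ⟨x, hx⟩ := exists_sum_mul_smul_ne_zero (fun g : H => ((θ g)⁻¹ : Mˣ).val) 1 (by simp)
  refine ⟨_, hx, fun g => ?_⟩
  rw [Finset.smul_sum, Finset.mul_sum, ← Equiv.sum_comp (Equiv.mulLeft g)
    (fun h => (θ g : M) * (((θ h)⁻¹ : Mˣ).val * h • x))]
  refine Finset.sum_congr rfl fun h _ => ?_
  simp only [smul_mul', Equiv.coe_mulLeft, mul_smul, map_mul, mul_inv_rev, Units.val_mul,
    Units.val_inv_eq_inv_val, smul_inv'', hθ]
  field_simp

/-- The trace from `M` to the fixed field of `H` is onto, so it takes the value `1`. -/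
theorem exists_sum_smul_eq_one : ∃ t : M, ∑ g : H, g • t = 1 := by
  obtain ⟨x, hx⟩ := exists_sum_mul_smul_ne_zero (fun _ : H => (1 : M)) 1 one_ne_zero
  simp only [one_mul] at hx
  refine ⟨(∑ g : H, g • x)⁻¹ * x, ?_⟩
  have hfix (h : H) : h • (∑ g : H, g • x) = ∑ g : H, g • x := by
    rw [Finset.smul_sum, ← Equiv.sum_comp (Equiv.mulLeft h) fun g : H => g • x]
    simp [mul_smul]
  simp only [smul_mul', smul_inv'', hfix, ← Finset.mul_sum]
  exact inv_mul_cancel₀ hx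

/-- The additive group of `M` has trivial first cohomology. -/
theorem exists_eq_sub_smul_of_cocycle (d : H → M) (hd : ∀ g h, d (g * h) = d g + g • d h) :
    ∃ x : M, ∀ g, d g = x - g • x := by
  obtain ⟨t, ht⟩ := exists_sum_smul_eq_one (H := H) (M := M)
  refine ⟨∑ h, d h * h • t, fun g => ?_⟩
  have h1 : g • (∑ h, d h * h • t) = ∑ h, (d h - d g) * h • t := by
    rw [Finset.smul_sum, ← Equiv.sum_comp (Equiv.mulLeft g) fun h => (d h - d g) * h • t]
    refine Finset.sum_congr rfl fun h _ => ?_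
    simp [smul_mul', mul_smul, hd]
  rw [h1, ← Finset.sum_sub_distrib]
  simp only [← sub_mul, sub_sub_cancel]
  rw [← Finset.mul_sum, ht, mul_one]

/-- The additive group of `M` has trivial second cohomology. -/
theorem exists_coboundary_of_cocycle₂ (c : H → H → M)
    (hc : ∀ g h k, g • c h k - c (g * h) k + c g (h * k) - c g h = 0) :
    ∃ b : H → M, ∀ g h, b g + g • b h - b (g * h) = c g h := by
  obtain ⟨t, ht⟩ := exists_sum_smul_eq_one (H := H) (M := M)
  refine ⟨fun g => ∑ k, c g k * (g * k) • t, fun g h => ?_⟩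
  have h0 : ∑ k, (g * h * k) • t = 1 := by
    rw [← ht, ← Equiv.sum_comp (Equiv.mulLeft (g * h)) fun k => k • t]; rfl
  have h1 : ∑ k, c g k * (g * k) • t = ∑ k, c g (h * k) * (g * h * k) • t := by
    rw [← Equiv.sum_comp (Equiv.mulLeft h) fun k => c g k * (g * k) • t]
    simp [mul_assoc]
  beta_reduce
  rw [h1, Finset.smul_sum, ← Finset.sum_add_distrib, ← Finset.sum_sub_distrib,
    ← mul_one (c g h), ← h0, Finset.mul_sum]
  refine Finset.sum_congr rfl fun k _ => ?_
  rw [smul_mul', ← mul_smul, ← mul_assoc]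
  linear_combination ((g * h * k) • t) * hc g h k

end FiniteGroup

/-! ### Characters of groups -/

/-- A continuous character, given here by its triviality near `1`, kills the closed commutator
subgroup. -/
theorem map_eq_one_of_mem_closure_commutator {K A : Type*} [Group K] [TopologicalSpace K]
    [IsTopologicalGroup K] [CommGroup A] (ψ : K →* A) (hψ : ∀ᶠ g in 𝓝 1, ψ g = 1)
    {g : K} (hg : g ∈ (commutator K).topologicalClosure) : ψ g = 1 := by
  have hopen : IsOpen (ψ.ker : Set K) := ψ.ker.isOpen_of_mem_nhds (g := 1) hψ
  exact Subgroup.topologicalClosure_minimal _ (Abelianization.commutator_subset_ker ψ)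
    (ψ.ker.isClosed_of_isOpen hopen) hg

/-- In a finite group, an element outside the commutator subgroup whose `p`-th power lies in it is
detected by a character of `p`-power order. -/
theorem exists_character_ne_one_of_notMem_commutator {H : Type*} [Group H] [Finite H] {p : ℕ}
    (hp : p.Prime) {h : H} (h1 : h ∉ commutator H) (h2 : h ^ p ∈ commutator H) :
    ∃ (e : ℕ) (χ : H →* Multiplicative (ZMod (p ^ e))), χ h ≠ 1 := by
  classical
  obtain ⟨ι, _, q, hq, e, ⟨f⟩⟩ :=
    AddCommGroup.equiv_directSum_zmod_of_finite (Additive (Abelianization H))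
  have hne : f (Additive.ofMul (Abelianization.of h)) ≠ 0 := by
    rw [Ne, EmbeddingLike.map_eq_zero_iff, ofMul_eq_zero, ← MonoidHom.mem_ker,
      Abelianization.ker_of]
    exact h1
  have hpz : p • f (Additive.ofMul (Abelianization.of h)) = 0 := by
    rw [← map_nsmul, EmbeddingLike.map_eq_zero_iff, ← ofMul_pow, ofMul_eq_zero, ← map_pow,
      ← MonoidHom.mem_ker, Abelianization.ker_of]
    exact h2
  obtain ⟨i, hi⟩ : ∃ i, f (Additive.ofMul (Abelianization.of h)) i ≠ 0 := by
    by_contra! hall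
    exact hne (DFinsupp.ext hall)
  have hpi : p • f (Additive.ofMul (Abelianization.of h)) i = 0 :=
    DFunLike.congr_fun hpz i
  -- Multiplication by `p` is injective on `ZMod (q ^ e)` for a prime `q ≠ p`.
  have hqp : q i = p := by
    by_contra hqp
    have hcop : Nat.Coprime p (q i ^ e i) :=
      Nat.Coprime.pow_right _ ((Nat.coprime_primes hp (hq i)).2 (Ne.symm hqp))
    rw [nsmul_eq_mul] at hpi
    exact hi (((ZMod.isUnit_iff_coprime _ _).2 hcop).mul_right_eq_zero.1 hpi)
  have key : ∃ χ : H →* Multiplicative (ZMod (q i ^ e i)), χ h ≠ 1 :=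
    ⟨(AddMonoidHom.toMultiplicativeRight
      ((DFinsupp.evalAddMonoidHom i).comp f.toAddMonoidHom)).comp Abelianization.of,
      fun hh => hi hh⟩
  rw [hqp] at key
  exact ⟨e i, key⟩

/-! ### Divisibility of characters of subgroups of the Galois group -/

section Galois

variable {F Ω : Type*} [Field F] [Field Ω] [Algebra F Ω]

/-- The restriction of a subgroup `K` of the Galois group to a normal subextension `M`. -/
noncomputable def restrictSubgroupHom (K : Subgroup Gal(Ω/F)) (M : IntermediateField F Ω)
    [Normal F M] : K →* Gal(M/F) :=
  (AlgEquiv.restrictNormalHom M).comp K.subtype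

theorem restrictSubgroupHom_apply (K : Subgroup Gal(Ω/F)) (M : IntermediateField F Ω)
    [Normal F M] (τ : K) (x : M) : (restrictSubgroupHom K M τ x : Ω) = (τ : Gal(Ω/F)) x :=
  AlgEquiv.restrictNormalHom_apply M τ x

theorem eventually_apply_eq [Algebra.IsIntegral F Ω] (K : Subgroup Gal(Ω/F)) (y : Ω) :
    ∀ᶠ τ : K in 𝓝 1, (τ : Gal(Ω/F)) y = y :=
  continuous_subtype_val.continuousAt.eventually
    ((stabilizer_isOpen_of_isIntegral (K := F) y).mem_nhds (one_mem _))

theorem eventually_restrictSubgroupHom_eq_one (K : Subgroup Gal(Ω/F))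
    (M : IntermediateField F Ω) [Normal F M] [FiniteDimensional F M] :
    ∀ᶠ τ : K in 𝓝 1, restrictSubgroupHom K M τ = 1 := by
  have h : ∀ᶠ τ : K in 𝓝 1, (τ : Gal(Ω/F)) ∈ M.fixingSubgroup :=
    continuous_subtype_val.continuousAt.eventually
      (M.fixingSubgroup_isOpen.mem_nhds (one_mem _))
  filter_upwards [h] with τ hτ
  ext x
  rw [restrictSubgroupHom_apply]
  exact (IntermediateField.mem_fixingSubgroup_iff _ _).1 hτ x x.2

/-- Kummer theory: if `F` contains all roots of unity, a character `θ` of a finite quotient of `K`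
with values in `Fˣ` has a `p`-th root among the continuous characters of `K`, and therefore kills
every `σ` whose `p`-th power lies in the closed commutator subgroup. If `θ` is `τ ↦ τ α / α` and
`β ^ p = α`, that `p`-th root is `τ ↦ τ β / β`. -/
theorem kummer_character_eq_one [IsAlgClosed Ω] [Algebra.IsIntegral F Ω]
    (hF : ∀ n : ℕ, 0 < n → ∀ ζ : Ω, ζ ^ n = 1 → ζ ∈ Set.range (algebraMap F Ω))
    {p : ℕ} (hp : 0 < p) (K : Subgroup Gal(Ω/F)) (M : IntermediateField F Ω) [Normal F M]
    [FiniteDimensional F M] (θ : (restrictSubgroupHom K M).range →* Fˣ) {σ : K}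
    (hσ : σ ^ p ∈ (commutator K).topologicalClosure) :
    θ ((restrictSubgroupHom K M).rangeRestrict σ) = 1 := by
  have := Fintype.ofFinite (restrictSubgroupHom K M).range
  set π := (restrictSubgroupHom K M).rangeRestrict
  obtain ⟨α, hα0, hα⟩ := exists_smul_eq_character_mul
    ((Units.map (algebraMap F M : F →* M)).comp θ)
    (fun g h => (g : Gal(M/F)).commutes (θ h : F))
  have hKα (τ : K) : (τ : Gal(Ω/F)) (α : Ω) = algebraMap F Ω (θ (π τ)) * α := by
    rw [← restrictSubgroupHom_apply]
    exact congrArg Subtype.val (hα (π τ))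
  have hα0' : (α : Ω) ≠ 0 := by simpa using hα0
  obtain ⟨β, hβ⟩ := IsAlgClosed.exists_pow_nat_eq (α : Ω) hp
  have hβ0 : β ≠ 0 := by rintro rfl; exact hα0' (by rw [← hβ, zero_pow hp.ne'])
  have hpow (τ : K) : ((τ : Gal(Ω/F)) β / β) ^ p = algebraMap F Ω (θ (π τ)) := by
    rw [div_pow, ← map_pow, hβ, hKα, mul_div_cancel_right₀ _ hα0']
  have hfix (ρ τ : K) : (ρ : Gal(Ω/F)) ((τ : Gal(Ω/F)) β / β) = (τ : Gal(Ω/F)) β / β := by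
    -- `τ β / β` is a root of unity, since `θ` has finite order.
    obtain ⟨z, hz⟩ := hF (p * orderOf (π τ)) (Nat.mul_pos hp (orderOf_pos _))
      ((τ : Gal(Ω/F)) β / β) (by
        rw [pow_mul, hpow, ← map_pow, ← Units.val_pow_eq_pow_val, ← map_pow, pow_orderOf_eq_one]
        simp)
    rw [← hz, AlgEquiv.commutes]
  -- As its values are fixed by `K`, the cocycle `τ β / β` is a homomorphism.
  let ψ : K →* Ω :=
    { toFun := fun τ => (τ : Gal(Ω/F)) β / β
      map_one' := div_self hβ0
      map_mul' := fun ρ τ => by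
        have h := hfix ρ τ
        rw [map_div₀, div_eq_iff (by simpa using hβ0)] at h
        rw [Subgroup.coe_mul, AlgEquiv.mul_apply, h, mul_div_assoc, mul_comm] }
  have h1 : ψ.toHomUnits (σ ^ p) = 1 := by
    refine map_eq_one_of_mem_closure_commutator _ ?_ hσ
    filter_upwards [eventually_apply_eq K β] with τ hτ
    ext
    change (τ : Gal(Ω/F)) β / β = 1
    rw [hτ, div_self hβ0]
  have h2 : ψ σ ^ p = 1 := by
    rw [← map_pow]; exact congrArg Units.val h1
  ext
  apply (algebraMap F Ω).injective
  rw [← hpow, Units.val_one, map_one]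
  exact h2

/-- Artin–Schreier theory: in characteristic `p`, a character of a finite quotient of `K` with
values in `ZMod (p ^ e)` lifts to a continuous character of `K` with values in
`ZMod (p ^ (e + 1))`, and therefore kills every `σ` whose `p`-th power lies in the closed
commutator subgroup. The obstruction to lifting `χ`, the carry cocycle with values in `ZMod p`, is a
coboundary `δb` in `M`; a solution `y` of `y ^ p - y = x` in `Ω`, for suitable `x`, corrects `b` to
a cochain `h` with values in `ZMod p`. -/
theorem artinSchreier_character_eq_one [IsAlgClosed Ω] [Algebra.IsIntegral F Ω]
    {p : ℕ} (hp : p.Prime) [CharP F p] (K : Subgroup Gal(Ω/F)) (M : IntermediateField F Ω)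
    [Normal F M] [FiniteDimensional F M] {e : ℕ}
    (χ : (restrictSubgroupHom K M).range →* Multiplicative (ZMod (p ^ e))) {σ : K}
    (hσ : σ ^ p ∈ (commutator K).topologicalClosure) :
    χ ((restrictSubgroupHom K M).rangeRestrict σ) = 1 := by
  have := Fintype.ofFinite (restrictSubgroupHom K M).range
  have : Fact p.Prime := ⟨hp⟩
  have : CharP Ω p := charP_of_injective_algebraMap (algebraMap F Ω).injective p
  have : CharP M p := charP_of_injective_algebraMap (algebraMap F M).injective p
  have hq : NeZero (p ^ e) := ⟨pow_ne_zero _ hp.ne_zero⟩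
  set π := (restrictSubgroupHom K M).rangeRestrict
  let v (g : (restrictSubgroupHom K M).range) : ℕ := (χ g).toAdd.val
  -- The carry in the addition of representatives of `χ g` and `χ h`.
  let c (g h : (restrictSubgroupHom K M).range) : ℕ := (v g + v h) / p ^ e
  have hv (g h) : v g + v h = v (g * h) + p ^ e * c g h := by
    have : v (g * h) = (v g + v h) % p ^ e := by
      simp only [v, map_mul, toAdd_mul, ZMod.val_add]
    rw [this, Nat.mod_add_div]
  have hcc (g h k) : c h k + c g (h * k) = c (g * h) k + c g h := by
    apply Nat.eq_of_mul_eq_mul_left hq.pos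
    have h1 := hv g h
    have h2 := hv h k
    have h3 := hv (g * h) k
    have h4 := hv g (h * k)
    rw [← mul_assoc] at h4
    linarith
  obtain ⟨b, hb⟩ := exists_coboundary_of_cocycle₂ (M := M) (fun g h => (c g h : M))
    (fun g h k => by
      have h1 : g • (c h k : M) = c h k := map_natCast (g : Gal(M/F)) _
      have h2 : (c h k + c g (h * k) : M) = c (g * h) k + c g h := by
        simpa using congrArg (Nat.cast : ℕ → M) (hcc g h k)
      rw [h1]
      linear_combination h2)
  -- Frobenius fixes the carries, so `b ^ p - b` is a cocycle.
  obtain ⟨x, hx⟩ := exists_eq_sub_smul_of_cocycle (fun g => b g ^ p - b g) (fun g h => by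
    have h1 : b (g * h) = b g + g • b h - c g h := by rw [← hb]; ring
    have h2 : ((c g h : M)) ^ p = c g h := by
      rw [← frobenius_def, map_natCast]
    rw [h1, sub_pow_char, add_pow_char, h2, smul_sub, smul_pow']
    ring)
  obtain ⟨y, hy⟩ : ∃ y : Ω, y ^ p - y = x := by
    obtain ⟨y, hy⟩ := IsAlgClosed.exists_root (k := Ω)
      (Polynomial.X ^ p - Polynomial.X - Polynomial.C (x : Ω)) (by
        have h : (Polynomial.X ^ p - Polynomial.X : Polynomial Ω).degree = p := by
          rw [Polynomial.degree_eq_natDegree (FiniteField.X_pow_card_sub_X_ne_zero Ω hp.one_lt),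
            FiniteField.X_pow_card_sub_X_natDegree_eq Ω hp.one_lt]
        rw [Polynomial.degree_sub_C (by rw [h]; exact_mod_cast hp.pos), h]
        exact_mod_cast hp.ne_zero)
    exact ⟨y, by simpa [sub_eq_zero] using hy⟩
  -- The corrected cochain has values in the prime field, as it is fixed by Frobenius.
  have hex (τ : K) : ∃ n : ZMod p, ZMod.castHom dvd_rfl Ω n = b (π τ) - (y - (τ : Gal(Ω/F)) y) := by
    have hxτ : (b (π τ) : Ω) ^ p - b (π τ) = x - (τ : Gal(Ω/F)) x := by
      rw [← restrictSubgroupHom_apply]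
      exact congrArg Subtype.val (hx (π τ))
    obtain ⟨n, hn⟩ := (mem_bot_iff_intCast p Ω).1
      ((Subfield.mem_bot_iff_pow_eq_self (p := p)
        (x := (b (π τ) : Ω) - (y - (τ : Gal(Ω/F)) y))).2 (by
          rw [sub_pow_char, sub_pow_char, ← map_pow]
          have h1 : y ^ p = x + y := by rw [← hy]; ring
          rw [h1, map_add]
          linear_combination hxτ))
    exact ⟨n, by simpa using hn⟩
  choose h hh using hex
  have hmul (ρ τ : K) : h ρ + h τ = h (ρ * τ) + c (π ρ) (π τ) := by
    apply (ZMod.castHom dvd_rfl Ω : ZMod p →+* Ω).injective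
    have h1 : (ρ : Gal(Ω/F)) (ZMod.castHom dvd_rfl Ω (h τ)) = ZMod.castHom dvd_rfl Ω (h τ) := by
      obtain ⟨n, hn⟩ := ZMod.intCast_surjective (h τ)
      rw [← hn, map_intCast, map_intCast]
    have h2 : (b (π ρ) : Ω) + (ρ : Gal(Ω/F)) (b (π τ)) - b (π (ρ * τ)) = c (π ρ) (π τ) := by
      rw [← restrictSubgroupHom_apply, map_mul]
      exact congrArg Subtype.val (hb (π ρ) (π τ))
    rw [map_add, map_add, ← h1, hh, hh, hh, map_natCast, ← h2, map_sub, map_sub,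
      Subgroup.coe_mul, AlgEquiv.mul_apply]
    ring
  have hpp : (p : ZMod (p ^ (e + 1))) * (p : ZMod (p ^ (e + 1))) ^ e = 0 := by
    rw [← pow_succ', ← Nat.cast_pow, ZMod.natCast_self]
  -- The lift of `χ`, corrected by `h` to be additive.
  let f (τ : K) : ZMod (p ^ (e + 1)) := v (π τ) - (p : ZMod (p ^ (e + 1))) ^ e * (h τ).val
  have hf (ρ τ : K) : f (ρ * τ) = f ρ + f τ := by
    have h1 : ((v (π ρ) + v (π τ) : ℕ) : ZMod (p ^ (e + 1))) = _ := congrArg _ (hv (π ρ) (π τ))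
    obtain ⟨k, hk⟩ : (p : ℤ) ∣ (h ρ).val + (h τ).val - ((h (ρ * τ)).val + c (π ρ) (π τ)) := by
      rw [← ZMod.intCast_zmod_eq_zero_iff_dvd]
      push_cast
      rw [ZMod.natCast_zmod_val, ZMod.natCast_zmod_val, ZMod.natCast_zmod_val, hmul, sub_self]
    have h2 := congrArg (Int.cast : ℤ → ZMod (p ^ (e + 1))) hk
    push_cast at h1 h2
    simp only [f, map_mul]
    linear_combination (p : ZMod (p ^ (e + 1))) ^ e * h2 - h1 + k * hpp
  let ψ : K →* Multiplicative (ZMod (p ^ (e + 1))) :=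
    MonoidHom.mk' (fun τ => Multiplicative.ofAdd (f τ)) fun ρ τ => by rw [hf, ofAdd_add]
  have h1 : ψ (σ ^ p) = 1 := by
    refine map_eq_one_of_mem_closure_commutator _ ?_ hσ
    filter_upwards [eventually_apply_eq K y, eventually_restrictSubgroupHom_eq_one K M]
      with τ hτ hτ'
    -- `ψ τ` depends only on `π τ` and `τ y`.
    have hπ : π τ = π 1 := Subtype.ext (by simpa [π] using hτ')
    have hh1 : h τ = h 1 := (ZMod.castHom dvd_rfl Ω : ZMod p →+* Ω).injective (by
      rw [hh, hh, hπ, hτ]; simp)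
    rw [← map_one ψ]
    change Multiplicative.ofAdd (f τ) = Multiplicative.ofAdd (f 1)
    simp only [f, hπ, hh1]
  have h2 : (p : ZMod (p ^ (e + 1))) * f σ = 0 := by
    rw [map_pow] at h1
    rw [← nsmul_eq_mul]
    exact h1
  have h3 : ((p * v (π σ) : ℕ) : ZMod (p ^ (e + 1))) = 0 := by
    push_cast
    linear_combination h2 + (h σ).val * hpp
  rw [ZMod.natCast_eq_zero_iff, pow_succ'] at h3
  have h4 : v (π σ) = 0 :=
    Nat.eq_zero_of_dvd_of_lt (Nat.dvd_of_mul_dvd_mul_left hp.pos h3) (ZMod.val_lt _)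
  exact (ZMod.val_eq_zero _).1 h4

/-! ### Torsion-freeness -/

/-- The topological abelianization of `K` has no element of prime order. If `σ` is not in the closure
of the commutator subgroup, this is visible in a finite quotient of `K`, where a character `χ` of
`p`-power order detects `σ`; but `χ` has a `p`-th root over `K`, so it kills every `σ` whose `p`-th
power lies in that closure. -/
theorem mem_closure_commutator_of_pow_mem [IsAlgClosed Ω] [Algebra.IsIntegral F Ω]
    (hF : ∀ n : ℕ, 0 < n → ∀ ζ : Ω, ζ ^ n = 1 → ζ ∈ Set.range (algebraMap F Ω))
    {p : ℕ} (hp : p.Prime) (K : Subgroup Gal(Ω/F)) {σ : K}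
    (hσ : σ ^ p ∈ (commutator K).topologicalClosure) :
    σ ∈ (commutator K).topologicalClosure := by
  have : IsAlgClosure F Ω := ⟨inferInstance, inferInstance⟩
  have : Normal F Ω := IsAlgClosure.normal F Ω
  by_contra hσ'
  have : ∃ (M : IntermediateField F Ω) (_ : FiniteDimensional F M) (_ : Normal F M),
      ∀ τ : K, τ ∈ commutator K → restrictSubgroupHom K M τ ≠ restrictSubgroupHom K M σ := by
    have hnhds : (fun τ : K => σ * τ) ⁻¹' ((commutator K).topologicalClosure : Set K)ᶜ ∈ 𝓝 1 :=
      (continuous_const_mul σ).continuousAt.preimage_mem_nhds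
        ((Subgroup.isClosed_topologicalClosure _).isOpen_compl.mem_nhds hσ')
    -- By continuity, every `τ` in `K` close to `σ`, here `σ * ρ` with `ρ` trivial on a finite
    -- normal `M`, stays outside the closed subgroup.
    obtain ⟨t, ht, htK⟩ := mem_nhds_induced _ _ _ |>.1 hnhds
    obtain ⟨M, hfin, hnorm, hMt⟩ := (krullTopology_mem_nhds_one_iff_of_normal F Ω t).1 ht
    refine ⟨M, hfin, hnorm, fun τ hτ heq => ?_⟩
    have hmem : ((σ⁻¹ * τ : K) : Gal(Ω/F)) ∈ M.fixingSubgroup := by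
      rw [IntermediateField.mem_fixingSubgroup_iff]
      intro x hx
      have h1 : restrictSubgroupHom K M (σ⁻¹ * τ) = 1 := by
        rw [map_mul, map_inv, heq, inv_mul_cancel]
      have h2 := restrictSubgroupHom_apply K M (σ⁻¹ * τ) ⟨x, hx⟩
      rw [h1] at h2
      exact h2.symm
    have hnot := htK (hMt hmem)
    rw [Set.mem_preimage, mul_inv_cancel_left] at hnot
    exact hnot (Subgroup.le_topologicalClosure _ hτ)
  obtain ⟨M, _, _, hM⟩ := this
  set π := (restrictSubgroupHom K M).rangeRestrict
  have hmap : (commutator K).map π = commutator (restrictSubgroupHom K M).range := by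
    rw [commutator_def, commutator_def, Subgroup.map_commutator, ← MonoidHom.range_eq_map,
      MonoidHom.range_eq_top.2 (MonoidHom.rangeRestrict_surjective _)]
  have h1 : π σ ∉ commutator (restrictSubgroupHom K M).range := by
    rw [← hmap]
    rintro ⟨τ, hτ, h⟩
    exact hM τ hτ (congrArg Subtype.val h)
  have h2 : π σ ^ p ∈ commutator (restrictSubgroupHom K M).range := by
    have h := map_eq_one_of_mem_closure_commutator (Abelianization.of.comp π) (by
      filter_upwards [eventually_restrictSubgroupHom_eq_one K M] with τ hτ
      have : π τ = 1 := Subtype.ext hτ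
      simp [this]) hσ
    rw [← Abelianization.ker_of, MonoidHom.mem_ker, ← map_pow]
    exact h
  obtain ⟨e, χ, hχ⟩ := exists_character_ne_one_of_notMem_commutator hp h1 h2
  by_cases hpF : (p : F) = 0
  · have : CharP F p := (CharP.charP_iff_prime_eq_zero hp).2 hpF
    exact hχ (artinSchreier_character_eq_one hp K M χ hσ)
  · have : NeZero ((p : Ω)) := ⟨by
      rw [← map_natCast (algebraMap F Ω)]
      exact (map_ne_zero_iff _ (algebraMap F Ω).injective).2 hpF⟩
    obtain ⟨ζ, hζ⟩ := HasEnoughRootsOfUnity.exists_primitiveRoot Ω (p ^ e)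
    obtain ⟨ζ, rfl⟩ := hF _ (pow_pos hp.pos e) ζ hζ.pow_eq_one
    have hζ' := hζ.of_map_of_injective (algebraMap F Ω).injective
    have : NeZero (p ^ e) := ⟨pow_ne_zero _ hp.ne_zero⟩
    obtain ⟨φ, hφ⟩ := ZMod.exists_monoidHom_apply_ne_one ⟨ζ, hζ'⟩ (a := (χ (π σ)).toAdd) hχ
    exact hφ (kummer_character_eq_one hF hp.pos K M (φ.comp χ) hσ)

theorem totallyTorsionFree_gal [IsAlgClosed Ω] [Algebra.IsIntegral F Ω]
    (hF : ∀ n : ℕ, 0 < n → ∀ ζ : Ω, ζ ^ n = 1 → ζ ∈ Set.range (algebraMap F Ω)) :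
    TotallyTorsionFree Gal(Ω/F) := by
  refine ⟨krullTopology_t2, fun K _ => IsMulTorsionFree.of_not_isOfFinOrder fun a ha hfin => ?_⟩
  obtain ⟨p, hp, k, hk⟩ := Nat.exists_prime_and_dvd (orderOf_eq_one_iff.not.2 ha)
  have hk0 : 0 < k := Nat.pos_of_ne_zero fun h => by
    rw [h, mul_zero] at hk
    exact (orderOf_pos_iff.2 hfin).ne' hk
  obtain ⟨σ, hσ⟩ := QuotientGroup.mk_surjective (a ^ k)
  have hpσ : σ ^ p ∈ (commutator K).topologicalClosure := by
    rw [← QuotientGroup.eq_one_iff, QuotientGroup.mk_pow, hσ, ← pow_mul, mul_comm, ← hk]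
    exact pow_orderOf_eq_one a
  have h1 : a ^ k = 1 := by
    rw [← hσ]
    exact (QuotientGroup.eq_one_iff _).2 (mem_closure_commutator_of_pow_mem hF hp K hpσ)
  have h2 := Nat.le_of_dvd hk0 (orderOf_dvd_of_pow_eq_one h1)
  have := hp.two_le
  nlinarith

end Galois

theorem mainTheorem1 (F : Type*) [Field F] (hF : ContainsAllRootsOfUnity F) :
    TotallyTorsionFree (Field.absoluteGaloisGroup F) := by
  change TotallyTorsionFree Gal(AlgebraicClosure F/F)
  exact totallyTorsionFree_gal hF
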